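/- For $N\in\mathbb N$ and probabilities $p_A,p_B,p_{eA},p_{eB},p_{eAB}$ with $p_A+p_B\le 1$, let $H(N,p_A,p_B,p_{eA},p_{eB},p_{eAB})$ be the random graph sampled as follows. Independently for each element of $[N]$, put it in $A$ with probability $p_A$, in $B$ with probability $p_B$, and discard it with probability $1-p_A-p_B$. The vertex set is $A\cup B$. Given $A$ and $B$, each pair of distinct vertices becomes an edge independently, with probability $p_{eA}$ if both lie in $A$, $p_{eB}$ if both lie in $B$, and $p_{eAB}$ if one lies in $A$ and the other in $B$. For a finite graph without isolated vertices and with at least two vertices, with adjacency matrix $M$ and degree matrix $D$, the normalized Laplacian is $\mathcal L=D^{-1/2}(D-M)D^{-1/2}$, and the spectral gap is the second smallest eigenvalue of $\mathcal L$, counted with multiplicity. **Lemma.** Let $d\ge 1$ be an integer, let $0<\alpha<1/d$ and let $\delta>0$. Then with overwhelming probability the random graph $$H\sim H\bigl(n-2d,\; n^{-d\alpha}(1-n^{-\alpha})^d,\; n^{-d\alpha}(1-n^{-\alpha})^d,\; 0,\; 0,\; 1-n^{-\alpha}\bigr)$$ has at least two vertices and no isolated vertices, and the spectral gap of its normalized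 Laplacian is larger than $1-\delta$. Here "with overwhelming probability" means that there is a function $\omega\colon\mathbb N\to\mathbb R$ with $\omega(n)\to\infty$ such that, for all sufficiently large $n$, the event has probability at least $1-n^{-\omega(n)}$. -/

import Mathlib

open MeasureTheory Filter Topology

/-- The three possible roles of a point of the ground set: it is put into `A`, put into `B`,
or excluded from the graph. -/
inductive Role : Type
  | A
  | B
  | out
  deriving DecidableEq

instance : Fintype Role := ⟨{Role.A, Role.B, Role.out}, by intro x; cases x <;> simp⟩

instance : MeasurableSpace Role := ⊤

instance : DiscreteMeasurableSpace Role := ⟨fun _ => trivial⟩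

/-- Law of the role of one point: `A` with probability `pA`, `B` with probability `pB`,
excluded with probability `1 - pA - pB`. -/
noncomputable def roleLaw (pA pB : ℝ) : Measure Role :=
  ENNReal.ofReal pA • Measure.dirac Role.A + ENNReal.ofReal pB • Measure.dirac Role.B
    + ENNReal.ofReal (1 - pA - pB) • Measure.dirac Role.out

/-- Law of a coin showing `true` with probability `p`. -/
noncomputable def coinLaw (p : ℝ) : Measure Bool :=
  ENNReal.ofReal p • Measure.dirac true + ENNReal.ofReal (1 - p) • Measure.dirac false

/-- The probability that the pair `e` becomes an edge, given the roles `c` of all points.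
(The value on loops is irrelevant, see `sampledGraph`.) -/
noncomputable def edgeProb {N : ℕ} (peA peB peAB : ℝ) (c : Fin N → Role) (e : Sym2 (Fin N)) : ℝ :=
  if e.map c = s(Role.A, Role.A) then peA
  else if e.map c = s(Role.B, Role.B) then peB
  else if e.map c = s(Role.A, Role.B) then peAB
  else 0

/-- The random graph model `H(N, pA, pB, peA, peB, peAB)`: first the roles of the `N` points are
drawn independently; given the roles, the edge indicators are drawn independently with the
probabilities `edgeProb`. An outcome consists of the roles and the edge indicators. -/
noncomputable def linkGraphLaw (N : ℕ) (pA pB peA peB peAB : ℝ) :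
    Measure ((Fin N → Role) × (Sym2 (Fin N) → Bool)) :=
  (Measure.pi fun _ : Fin N => roleLaw pA pB).bind fun c =>
    (Measure.pi fun e : Sym2 (Fin N) => coinLaw (edgeProb peA peB peAB c e)).map fun E => (c, E)

/-- The graph of an outcome. Its vertices are the points that were not excluded, and two distinct
vertices are adjacent when the indicator of their pair is `true`. -/
def sampledGraph {N : ℕ} (ω : (Fin N → Role) × (Sym2 (Fin N) → Bool)) :
    SimpleGraph {v : Fin N // ω.1 v ≠ Role.out} :=
  (SimpleGraph.fromEdgeSet {e | ω.2 e = true}).comap Subtype.val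

open Classical in
/-- The normalized Laplacian `D^(-1/2) (D - A) D^(-1/2)` (of a graph without isolated vertices). -/
noncomputable def normalizedLaplacian {V : Type*} [Fintype V] (G : SimpleGraph V) :
    Matrix V V ℝ :=
  Matrix.diagonal (fun v => (Real.sqrt (G.degree v))⁻¹) * G.lapMatrix ℝ *
    Matrix.diagonal (fun v => (Real.sqrt (G.degree v))⁻¹)

theorem normalizedLaplacian_isHermitian {V : Type*} [Fintype V] (G : SimpleGraph V) :
    (normalizedLaplacian G).IsHermitian := by
  classical
  have h : (G.lapMatrix ℝ).transpose = G.lapMatrix ℝ := G.isSymm_lapMatrix ℝ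
  rw [Matrix.IsHermitian, Matrix.conjTranspose_eq_transpose_of_trivial, normalizedLaplacian]
  simp only [Matrix.transpose_mul, Matrix.diagonal_transpose, Matrix.mul_assoc]
  rw [h]

open Classical in
/-- The spectral gap: the second smallest eigenvalue, counted with multiplicity, of the normalized
Laplacian. (`eigenvalues₀` lists the eigenvalues in decreasing order. Graphs with fewer than two
vertices have no spectral gap and get the value `0`.) -/
noncomputable def spectralGap {V : Type*} [Fintype V] (G : SimpleGraph V) : ℝ :=
  if h : 2 ≤ Fintype.card V then
    (normalizedLaplacian_isHermitian G).eigenvalues₀ ⟨Fintype.card V - 2, by omega⟩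
  else 0

/-- The graph has at least two vertices and no isolated vertex, so that its normalized Laplacian
and its spectral gap are defined, and the spectral gap is larger than `r`. -/
def SpectralGapGT {V : Type*} [Fintype V] (G : SimpleGraph V) (r : ℝ) : Prop :=
  2 ≤ Fintype.card V ∧ (∀ v, ¬ G.IsIsolated v) ∧ r < spectralGap G

/-- `P n`, the probability of the `n`-th event, is at least `1 - n ^ (-ω(1))`. -/
def WithOverwhelmingProbability (P : ℕ → ℝ) : Prop :=
  ∃ w : ℕ → ℝ, Tendsto w atTop atTop ∧ ∀ᶠ n : ℕ in atTop, 1 - (n : ℝ) ^ (-w n) ≤ P n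

/-- The model is a genuine probability space whenever the parameters are probabilities. -/
theorem isProbabilityMeasure_linkGraphLaw (N : ℕ) {pA pB peA peB peAB : ℝ}
    (hA : 0 ≤ pA) (hB : 0 ≤ pB) (hAB : pA + pB ≤ 1)
    (h1 : peA ∈ Set.Icc (0 : ℝ) 1) (h2 : peB ∈ Set.Icc (0 : ℝ) 1)
    (h3 : peAB ∈ Set.Icc (0 : ℝ) 1) :
    IsProbabilityMeasure (linkGraphLaw N pA pB peA peB peAB) := by
  have hrole : IsProbabilityMeasure (roleLaw pA pB) := ⟨by
    simp only [roleLaw, Measure.coe_add, Measure.coe_smul, Pi.add_apply, Pi.smul_apply,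
      measure_univ, smul_eq_mul, mul_one]
    rw [← ENNReal.ofReal_add hA hB, ← ENNReal.ofReal_add (by linarith) (by linarith)]
    simp⟩
  have hcoin : ∀ p ∈ Set.Icc (0 : ℝ) 1, IsProbabilityMeasure (coinLaw p) := fun p hp => ⟨by
    simp only [coinLaw, Measure.coe_add, Measure.coe_smul, Pi.add_apply, Pi.smul_apply,
      measure_univ, smul_eq_mul, mul_one]
    rw [← ENNReal.ofReal_add hp.1 (by linarith [hp.2])]
    simp⟩
  have hedge : ∀ (c : Fin N → Role) e, edgeProb peA peB peAB c e ∈ Set.Icc (0 : ℝ) 1 := by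
    intro c e
    unfold edgeProb
    split_ifs <;> first | assumption | simp
  have := fun c e => hcoin _ (hedge c e)
  refine ⟨?_⟩
  rw [linkGraphLaw, Measure.bind_apply MeasurableSet.univ (measurable_of_countable _).aemeasurable]
  have hmap : ∀ c : Fin N → Role, ((Measure.pi fun e : Sym2 (Fin N) =>
      coinLaw (edgeProb peA peB peAB c e)).map fun E => (c, E)) Set.univ = 1 := by
    intro c
    rw [Measure.map_apply (measurable_of_countable _) MeasurableSet.univ]
    simp
  simp [hmap]


/-!
Given the roles, the graph is almost surely a subgraph of the complete bipartite graph `K` between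
the two parts `A` and `B`. The quadratic form of the adjacency matrix of `K` vanishes on vectors
whose sum over `A` is zero, a space of codimension one, so there only the missing edges `K \ G`
contribute to the form of `G`, and their contribution is bounded by the missing degrees. By
Courant–Fischer, the spectral gap of `G` therefore exceeds `1 - δ` as soon as at every vertex the
number of missing edges is less than `δ` times the degree. Both parts have expected size at least
`n ^ (1 - dα + o(1))`, so by Chernoff bounds they are large, and at each vertex few edges are
missing, except with probability `n * exp (-n ^ (1 - dα + o(1)))`.
-/
section CourantFischer

variable {𝕜 E : Type*} [RCLike 𝕜] [NormedAddCommGroup E] [InnerProductSpace 𝕜 E]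
  [FiniteDimensional 𝕜 E] {T : E →ₗ[𝕜] E} {n : ℕ}

open scoped InnerProductSpace

theorem re_inner_apply_self_eq_sum_eigenvalues (hT : T.IsSymmetric)
    (hn : Module.finrank 𝕜 E = n) (x : E) :
    RCLike.re ⟪T x, x⟫_𝕜 =
      ∑ j, hT.eigenvalues hn j * ‖(hT.eigenvectorBasis hn).repr x j‖ ^ 2 := by
  rw [← (hT.eigenvectorBasis hn).repr.inner_map_map, PiLp.inner_apply, map_sum]
  refine Finset.sum_congr rfl fun j _ => ?_
  rw [hT.eigenvectorBasis_apply_self_apply hn, ← smul_eq_mul, inner_smul_left,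
    RCLike.conj_ofReal, RCLike.re_ofReal_mul, inner_self_eq_norm_sq]

/-- A subspace of dimension larger than `i` meets the span of the eigenvectors with indices
`j ≥ i`, on which the quadratic form is at most `eigenvalues i` times the squared norm. -/
theorem lt_eigenvalues_of_lt_finrank (hT : T.IsSymmetric) (hn : Module.finrank 𝕜 E = n)
    (i : Fin n) {W : Submodule 𝕜 E} (hW : i < Module.finrank 𝕜 W) {r : ℝ}
    (h : ∀ x ∈ W, x ≠ 0 → r * ‖x‖ ^ 2 < RCLike.re ⟪T x, x⟫_𝕜) :
    r < hT.eigenvalues hn i := by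
  set b := hT.eigenvectorBasis hn
  let lowerCoords : W →ₗ[𝕜] Finset.Iio i → 𝕜 :=
    LinearMap.pi fun j => b.toBasis.coord j ∘ₗ W.subtype
  obtain ⟨x, hx, hx0⟩ := Submodule.exists_mem_ne_zero_of_ne_bot
    (LinearMap.ker_ne_bot_of_finrank_lt (f := lowerCoords)
    (by rwa [Module.finrank_fintype_fun_eq_card, Fintype.card_coe, Fin.card_Iio]))
  have hcoord : ∀ j < i, b.repr x j = 0 := fun j hj => by
    simpa [lowerCoords] using congr_fun hx ⟨j, Finset.mem_Iio.mpr hj⟩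
  have hupper : RCLike.re ⟪T x, (x : E)⟫_𝕜 ≤ hT.eigenvalues hn i * ‖(x : E)‖ ^ 2 := by
    rw [re_inner_apply_self_eq_sum_eigenvalues hT hn, ← b.repr.norm_map, EuclideanSpace.norm_sq_eq,
      Finset.mul_sum]
    refine Finset.sum_le_sum fun j _ => ?_
    rcases lt_or_ge j i with hj | hj
    · simp [b, hcoord j hj]
    · exact mul_le_mul_of_nonneg_right (hT.eigenvalues_antitone hn hj) (sq_nonneg _)
  have hx0' : (x : E) ≠ 0 := by simpa using hx0
  exact lt_of_mul_lt_mul_right ((h x x.2 hx0').trans_le hupper) (sq_nonneg _)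

end CourantFischer

section SpectralGap

open Matrix

variable {V : Type*} [Fintype V]

open Classical in
theorem dotProduct_normalizedLaplacian_mulVec (G : SimpleGraph V) (x : V → ℝ) :
    x ⬝ᵥ normalizedLaplacian G *ᵥ x =
      (diagonal (fun v => (√(G.degree v))⁻¹) *ᵥ x) ⬝ᵥ
        G.lapMatrix ℝ *ᵥ diagonal (fun v => (√(G.degree v))⁻¹) *ᵥ x := by
  rw [normalizedLaplacian, ← mulVec_mulVec, ← mulVec_mulVec, dotProduct_mulVec,
    ← mulVec_transpose, diagonal_transpose]

theorem two_le_card_of_degree_ne_zero {G : SimpleGraph V} [DecidableRel G.Adj] {v : V}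
    (h : G.degree v ≠ 0) : 2 ≤ Fintype.card V :=
  (Nat.one_le_iff_ne_zero.mpr h).trans_lt (G.degree_lt_card_verts v)

open Classical in
theorem lt_spectralGap_of_forall_ker [Nonempty V] {G : SimpleGraph V}
    (hG : ∀ v, G.degree v ≠ 0) (f : (V → ℝ) →ₗ[ℝ] ℝ) {r : ℝ}
    (h : ∀ y, y ≠ 0 → f y = 0 → r * ∑ v, G.degree v * y v ^ 2 < y ⬝ᵥ G.lapMatrix ℝ *ᵥ y) :
    r < spectralGap G := by
  have hcard := two_le_card_of_degree_ne_zero (hG (Classical.arbitrary V))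
  set D : Matrix V V ℝ := diagonal fun v => (√(G.degree v))⁻¹
  let g : EuclideanSpace ℝ V →ₗ[ℝ] ℝ :=
    f ∘ₗ D.mulVecLin ∘ₗ (WithLp.linearEquiv 2 ℝ (V → ℝ)).toLinearMap
  rw [spectralGap, dif_pos hcard]
  refine lt_eigenvalues_of_lt_finrank _ finrank_euclideanSpace _ (W := g.ker) ?_
    fun x hx hx0 => ?_
  · have hrank := g.finrank_range_add_finrank_ker
    have hrange := g.range.finrank_le
    rw [finrank_euclideanSpace] at hrank
    rw [Module.finrank_self] at hrange
    simp only
    omega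
  have hDx : ∀ v, x v = √(G.degree v) * (D *ᵥ x) v := fun v => by
    have : √(G.degree v : ℝ) ≠ 0 := by simpa using hG v
    rw [mulVec_diagonal, mul_inv_cancel_left₀ this]
  have hne : D *ᵥ x ≠ 0 := fun h0 => hx0 <| by
    ext v
    simp [hDx, h0]
  have hnorm : ‖x‖ ^ 2 = ∑ v, G.degree v * (D *ᵥ x) v ^ 2 := by
    rw [EuclideanSpace.real_norm_sq_eq]
    refine Finset.sum_congr rfl fun v _ => ?_
    rw [hDx, mul_pow, Real.sq_sqrt (Nat.cast_nonneg _)]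
  calc r * ‖x‖ ^ 2 < (D *ᵥ x) ⬝ᵥ G.lapMatrix ℝ *ᵥ D *ᵥ x := hnorm ▸ h _ hne hx
    _ = x ⬝ᵥ normalizedLaplacian G *ᵥ x := (dotProduct_normalizedLaplacian_mulVec G x).symm
    _ = _ := by simp [EuclideanSpace.inner_eq_star_dotProduct, toLpLin_apply]

omit [Fintype V] in
theorem adjMatrix_sdiff {R : Type*} [AddGroupWithOne R] {G K : SimpleGraph V}
    [DecidableRel G.Adj] [DecidableRel K.Adj] (h : G ≤ K) :
    (K \ G).adjMatrix R = K.adjMatrix R - G.adjMatrix R := by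
  ext u v
  by_cases hG : G.Adj u v
  · simp [hG, h hG]
  · simp [hG]

theorem degree_add_degree_sdiff {G K : SimpleGraph V} [DecidableRel G.Adj]
    [DecidableRel K.Adj] (h : G ≤ K) (v : V) : G.degree v + (K \ G).degree v = K.degree v := by
  classical
  rw [← G.card_neighborFinset_eq_degree, ← (K \ G).card_neighborFinset_eq_degree,
    ← K.card_neighborFinset_eq_degree, SimpleGraph.neighborFinset_sdiff, add_comm]
  exact Finset.card_sdiff_add_card_eq_card fun w => by
    simpa only [SimpleGraph.mem_neighborFinset] using @h v w

theorem neg_dotProduct_adjMatrix_mulVec_le (G : SimpleGraph V) [DecidableRel G.Adj]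
    (y : V → ℝ) : -(y ⬝ᵥ G.adjMatrix ℝ *ᵥ y) ≤ ∑ v, G.degree v * y v ^ 2 := by
  have hdeg : ∑ v, (G.degree v : ℝ) * y v ^ 2 = ∑ u, ∑ v, if G.Adj u v then y u ^ 2 else 0 := by
    simp only [G.degree_eq_sum_if_adj (R := ℝ), Finset.sum_mul, ite_mul, one_mul, zero_mul]
  have hdeg' : ∑ v, (G.degree v : ℝ) * y v ^ 2 = ∑ u, ∑ v, if G.Adj u v then y v ^ 2 else 0 := by
    rw [hdeg, Finset.sum_comm]
    simp only [G.adj_comm]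
  have hsq : 0 ≤ ∑ u, ∑ v, if G.Adj u v then (y u + y v) ^ 2 else 0 := by positivity
  have hexpand : ∑ u, ∑ v, (if G.Adj u v then (y u + y v) ^ 2 else 0) =
      ∑ v, G.degree v * y v ^ 2 + 2 * (y ⬝ᵥ G.adjMatrix ℝ *ᵥ y) + ∑ v, G.degree v * y v ^ 2 := by
    nth_rw 1 [hdeg]
    rw [hdeg', G.dotProduct_mulVec_adjMatrix]
    simp only [Finset.mul_sum, ← Finset.sum_add_distrib]
    refine Finset.sum_congr rfl fun u _ => Finset.sum_congr rfl fun v _ => ?_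
    split_ifs <;> ring
  linarith

open Classical in
theorem dotProduct_adjMatrix_between_mulVec {S T : Set V} (hST : Disjoint S T) (y : V → ℝ) :
    y ⬝ᵥ ((⊤ : SimpleGraph V).between S T).adjMatrix ℝ *ᵥ y =
      2 * (S.indicator y ⬝ᵥ 1) * (T.indicator y ⬝ᵥ 1) := by
  have hterm : ∀ u v, (if ((⊤ : SimpleGraph V).between S T).Adj u v then y u * y v else 0) =
      S.indicator y u * T.indicator y v + T.indicator y u * S.indicator y v := fun u v => by
    have hu : u ∈ S → u ∉ T := fun h => Set.disjoint_left.mp hST h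
    have hv : v ∈ S → v ∉ T := fun h => Set.disjoint_left.mp hST h
    by_cases huv : u = v
    · subst huv
      by_cases u ∈ S <;> by_cases u ∈ T <;> simp_all
    · by_cases u ∈ S <;> by_cases u ∈ T <;> by_cases v ∈ S <;> by_cases v ∈ T <;>
        simp_all [SimpleGraph.between_adj]
  rw [SimpleGraph.dotProduct_mulVec_adjMatrix]
  simp only [hterm, Finset.sum_add_distrib, ← Finset.mul_sum, ← Finset.sum_mul, dotProduct_one]
  ring

open Classical in
/-- With `K` the complete bipartite graph, the Laplacian of `G` is `D - A_K + A_{K \ G}`. The form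
of `A_K` vanishes on vectors with sum zero over `S`, and that of `A_{K \ G}` is bounded below by
the missing degrees. -/
theorem spectralGapGT_of_le_between [Nonempty V] {G : SimpleGraph V} {S T : Set V}
    (hST : Disjoint S T) (hG : G ≤ (⊤ : SimpleGraph V).between S T) {δ : ℝ}
    (hdeg : ∀ v, (((⊤ : SimpleGraph V).between S T \ G).degree v : ℝ) < δ * G.degree v) :
    SpectralGapGT G (1 - δ) := by
  set K := (⊤ : SimpleGraph V).between S T
  have hdeg0 : ∀ v, G.degree v ≠ 0 := fun v h0 => by
    have := (Nat.cast_nonneg _).trans_lt (hdeg v)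
    simp [h0] at this
  refine ⟨two_le_card_of_degree_ne_zero (hdeg0 (Classical.arbitrary V)),
    fun v hv => hdeg0 v ((G.degree_eq_zero v).mpr hv), ?_⟩
  refine lt_spectralGap_of_forall_ker hdeg0
    (∑ v, S.indicator (fun v => LinearMap.proj v) v) fun y hy hsum => ?_
  have hS : S.indicator y ⬝ᵥ 1 = 0 := by
    rw [dotProduct_one, ← hsum, LinearMap.sum_apply]
    refine Finset.sum_congr rfl fun v _ => ?_
    by_cases hv : v ∈ S <;> simp [hv]
  have hK : y ⬝ᵥ K.adjMatrix ℝ *ᵥ y = 0 := by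
    rw [dotProduct_adjMatrix_between_mulVec hST, hS, mul_zero, zero_mul]
  have hmissing : y ⬝ᵥ G.adjMatrix ℝ *ᵥ y ≤ ∑ v, (K \ G).degree v * y v ^ 2 := by
    have := neg_dotProduct_adjMatrix_mulVec_le (K \ G) y
    rw [adjMatrix_sdiff hG, sub_mulVec, dotProduct_sub, hK, zero_sub, neg_neg] at this
    exact this
  have hstrict : ∑ v, (K \ G).degree v * y v ^ 2 < δ * ∑ v, G.degree v * y v ^ 2 := by
    obtain ⟨v, hv⟩ := Function.ne_iff.mp hy
    rw [Finset.mul_sum]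
    simp only [← mul_assoc]
    exact Finset.sum_lt_sum (fun v _ => mul_le_mul_of_nonneg_right (hdeg v).le (sq_nonneg _))
      ⟨v, Finset.mem_univ v, mul_lt_mul_of_pos_right (hdeg v) (pow_two_pos_of_ne_zero hv)⟩
  have hlap : y ⬝ᵥ G.lapMatrix ℝ *ᵥ y =
      ∑ v, G.degree v * y v ^ 2 - y ⬝ᵥ G.adjMatrix ℝ *ᵥ y := by
    rw [SimpleGraph.lapMatrix, sub_mulVec, dotProduct_sub, SimpleGraph.dotProduct_mulVec_degMatrix]
    simp only [pow_two, mul_assoc]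
  linarith

end SpectralGap

section Chernoff

open ProbabilityTheory
open scoped Finset

variable {Ω ι : Type*} [MeasurableSpace Ω] {μ : Measure Ω}

/-- By convexity of the exponential, `X` may be compared with a Bernoulli variable of the same
mean. -/
theorem mgf_le_exp_mul_integral_of_mem_Icc [IsProbabilityMeasure μ] {X : Ω → ℝ}
    (hX : AEMeasurable X μ) (h01 : ∀ᵐ ω ∂μ, X ω ∈ Set.Icc 0 1) (t : ℝ) :
    mgf X μ t ≤ Real.exp ((Real.exp t - 1) * μ[X]) := by
  have hint : Integrable X μ := Integrable.of_mem_Icc 0 1 hX h01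
  have hchord : ∀ x ∈ Set.Icc (0 : ℝ) 1, Real.exp (t * x) ≤ 1 + (Real.exp t - 1) * x :=
    fun x ⟨h0, h1⟩ => by
      have := convexOn_exp.2 (Set.mem_univ 0) (Set.mem_univ t) (sub_nonneg.mpr h1) h0
        (sub_add_cancel 1 x)
      simp only [smul_eq_mul, mul_zero, zero_add, Real.exp_zero, mul_one] at this
      rw [mul_comm t]
      linarith
  calc mgf X μ t ≤ ∫ ω, (1 + (Real.exp t - 1) * X ω) ∂μ :=
        integral_mono_ae (integrable_exp_mul_of_mem_Icc hX h01)
          ((integrable_const 1).add (hint.const_mul _)) (h01.mono fun ω => hchord (X ω))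
    _ = (Real.exp t - 1) * μ[X] + 1 := by
        rw [integral_add (integrable_const 1) (hint.const_mul _), integral_const_mul]
        simp [add_comm]
    _ ≤ Real.exp ((Real.exp t - 1) * μ[X]) := Real.add_one_le_exp _

section IndependentSum

variable {X : ι → Ω → ℝ}

theorem mgf_sum_le_exp_mul_sum_integral_of_mem_Icc (hindep : iIndepFun X μ)
    (hX : ∀ i, AEMeasurable (X i) μ) (h01 : ∀ i, ∀ᵐ ω ∂μ, X i ω ∈ Set.Icc 0 1) (s : Finset ι)
    (t : ℝ) : mgf (∑ i ∈ s, X i) μ t ≤ Real.exp ((Real.exp t - 1) * ∑ i ∈ s, μ[X i]) := by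
  have := hindep.isProbabilityMeasure
  rw [hindep.mgf_sum₀ hX, Finset.mul_sum, Real.exp_sum]
  exact Finset.prod_le_prod (fun _ _ => mgf_nonneg)
    fun i _ => mgf_le_exp_mul_integral_of_mem_Icc (hX i) (h01 i) t

theorem integrable_exp_mul_sum_of_mem_Icc [IsFiniteMeasure μ] (hX : ∀ i, AEMeasurable (X i) μ)
    (h01 : ∀ i, ∀ᵐ ω ∂μ, X i ω ∈ Set.Icc 0 1) (s : Finset ι) (t : ℝ) :
    Integrable (fun ω => Real.exp (t * (∑ i ∈ s, X i) ω)) μ := by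
  refine integrable_exp_mul_of_mem_Icc (a := 0) (b := #s)
    (Finset.aemeasurable_sum s fun i _ => hX i) ?_
  filter_upwards [(Finset.eventually_all s).mpr fun i _ => h01 i] with ω hω
  rw [Finset.sum_apply]
  exact ⟨Finset.sum_nonneg fun i hi => (hω i hi).1,
    (Finset.sum_le_card_nsmul s _ 1 fun i hi => (hω i hi).2).trans_eq (nsmul_one _)⟩

theorem measureReal_le_sum_le_exp (hindep : iIndepFun X μ) (hX : ∀ i, AEMeasurable (X i) μ)
    (h01 : ∀ i, ∀ᵐ ω ∂μ, X i ω ∈ Set.Icc 0 1) (s : Finset ι) (m : ℝ) :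
    μ.real {ω | m ≤ (∑ i ∈ s, X i) ω} ≤ Real.exp (2 * ∑ i ∈ s, μ[X i] - m) := by
  have := hindep.isProbabilityMeasure
  have hmean : 0 ≤ ∑ i ∈ s, μ[X i] :=
    Finset.sum_nonneg fun i _ => integral_nonneg_of_ae ((h01 i).mono fun _ h => h.1)
  have hbase : Real.exp 1 - 1 ≤ 2 := by linarith [Real.exp_one_lt_d9]
  calc μ.real {ω | m ≤ (∑ i ∈ s, X i) ω}
      ≤ Real.exp (-1 * m) * mgf (∑ i ∈ s, X i) μ 1 := measure_ge_le_exp_mul_mgf m zero_le_one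
        (integrable_exp_mul_sum_of_mem_Icc hX h01 s 1)
    _ ≤ Real.exp (-1 * m) * Real.exp ((Real.exp 1 - 1) * ∑ i ∈ s, μ[X i]) := by
        gcongr
        exact mgf_sum_le_exp_mul_sum_integral_of_mem_Icc hindep hX h01 s 1
    _ ≤ Real.exp (2 * ∑ i ∈ s, μ[X i] - m) := by
        rw [← Real.exp_add]
        gcongr
        linarith [mul_le_mul_of_nonneg_right hbase hmean]

theorem measureReal_sum_le_le_exp (hindep : iIndepFun X μ) (hX : ∀ i, AEMeasurable (X i) μ)
    (h01 : ∀ i, ∀ᵐ ω ∂μ, X i ω ∈ Set.Icc 0 1) (s : Finset ι) (m : ℝ) :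
    μ.real {ω | (∑ i ∈ s, X i) ω ≤ m} ≤ Real.exp (m - (∑ i ∈ s, μ[X i]) / 2) := by
  have := hindep.isProbabilityMeasure
  have hmean : 0 ≤ ∑ i ∈ s, μ[X i] :=
    Finset.sum_nonneg fun i _ => integral_nonneg_of_ae ((h01 i).mono fun _ h => h.1)
  have hbase : Real.exp (-1) - 1 ≤ -(1 / 2) := by linarith [Real.exp_neg_one_lt_half]
  calc μ.real {ω | (∑ i ∈ s, X i) ω ≤ m}
      ≤ Real.exp (-(-1) * m) * mgf (∑ i ∈ s, X i) μ (-1) :=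
        measure_le_le_exp_mul_mgf m (neg_nonpos.mpr zero_le_one)
          (integrable_exp_mul_sum_of_mem_Icc hX h01 s (-1))
    _ ≤ Real.exp (-(-1) * m) * Real.exp ((Real.exp (-1) - 1) * ∑ i ∈ s, μ[X i]) := by
        gcongr
        exact mgf_sum_le_exp_mul_sum_integral_of_mem_Icc hindep hX h01 s (-1)
    _ ≤ Real.exp (m - (∑ i ∈ s, μ[X i]) / 2) := by
        rw [← Real.exp_add]
        gcongr
        linarith [mul_le_mul_of_nonneg_right hbase hmean]

end IndependentSum

section ProductMeasure

theorem indicator_one_mem_Icc {α : Type*} (A : Set α) (a : α) :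
    A.indicator (1 : α → ℝ) a ∈ Set.Icc 0 1 :=
  ⟨Set.indicator_nonneg (fun _ _ => zero_le_one) a,
    Set.indicator_le_self' (fun _ _ => zero_le_one) a⟩

variable [Fintype ι] {α : ι → Type*} [∀ i, MeasurableSpace (α i)] (P : ∀ i, Measure (α i))
  [∀ i, IsProbabilityMeasure (P i)] {A : ∀ i, Set (α i)}

theorem iIndepFun_indicator_eval_pi (hA : ∀ i, MeasurableSet (A i)) :
    iIndepFun (fun i x => (A i).indicator (1 : α i → ℝ) (x i)) (Measure.pi P) :=
  iIndepFun_pi fun i => (measurable_one.indicator (hA i)).aemeasurable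

omit [∀ i, IsProbabilityMeasure (P i)] in
theorem aemeasurable_indicator_eval_pi (hA : ∀ i, MeasurableSet (A i)) (i : ι) :
    AEMeasurable (fun x => (A i).indicator (1 : α i → ℝ) (x i)) (Measure.pi P) :=
  ((measurable_one.indicator (hA i)).comp (measurable_pi_apply i)).aemeasurable

theorem integral_indicator_eval_pi (hA : ∀ i, MeasurableSet (A i)) (i : ι) :
    ∫ x, (A i).indicator (1 : α i → ℝ) (x i) ∂Measure.pi P = (P i).real (A i) := by
  rw [integral_comp_eval (μ := P) (measurable_one.indicator (hA i)).aestronglyMeasurable,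
    integral_indicator_one (hA i)]

omit [Fintype ι] [∀ i, MeasurableSpace (α i)] in
theorem sum_indicator_eval_eq_card [∀ i, DecidablePred (· ∈ A i)] (s : Finset ι)
    (x : ∀ i, α i) :
    (∑ i ∈ s, fun x : ∀ i, α i => (A i).indicator (1 : α i → ℝ) (x i)) x =
      #{i ∈ s | x i ∈ A i} := by
  rw [Finset.sum_apply, Finset.natCast_card_filter]
  exact Finset.sum_congr rfl fun i _ => Set.indicator_apply _ _ _

theorem measureReal_pi_le_card_le_exp [∀ i, DecidablePred (· ∈ A i)]
    (hA : ∀ i, MeasurableSet (A i)) (s : Finset ι) (m : ℝ) :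
    (Measure.pi P).real {x | m ≤ #{i ∈ s | x i ∈ A i}} ≤
      Real.exp (2 * ∑ i ∈ s, (P i).real (A i) - m) := by
  have := measureReal_le_sum_le_exp (iIndepFun_indicator_eval_pi P hA)
    (aemeasurable_indicator_eval_pi P hA)
    (fun i => ae_of_all _ fun x => indicator_one_mem_Icc (A i) (x i)) s m
  simpa only [sum_indicator_eval_eq_card, integral_indicator_eval_pi P hA] using this

theorem measureReal_pi_card_le_le_exp [∀ i, DecidablePred (· ∈ A i)]
    (hA : ∀ i, MeasurableSet (A i)) (s : Finset ι) (m : ℝ) :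
    (Measure.pi P).real {x | #{i ∈ s | x i ∈ A i} ≤ m} ≤
      Real.exp (m - (∑ i ∈ s, (P i).real (A i)) / 2) := by
  have := measureReal_sum_le_le_exp (iIndepFun_indicator_eval_pi P hA)
    (aemeasurable_indicator_eval_pi P hA)
    (fun i => ae_of_all _ fun x => indicator_one_mem_Icc (A i) (x i)) s m
  simpa only [sum_indicator_eval_eq_card, integral_indicator_eval_pi P hA] using this

end ProductMeasure

end Chernoff

section Model

open scoped Finset

variable {N : ℕ} {pA pB peA peB peAB p q : ℝ}

theorem isProbabilityMeasure_roleLaw (hA : 0 ≤ pA) (hB : 0 ≤ pB) (hAB : pA + pB ≤ 1) :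
    IsProbabilityMeasure (roleLaw pA pB) where
  measure_univ := by
    simp only [roleLaw, Measure.coe_add, Measure.coe_smul, Pi.add_apply, Pi.smul_apply,
      measure_univ, smul_eq_mul, mul_one]
    rw [← ENNReal.ofReal_add hA hB, ← ENNReal.ofReal_add (by linarith) (by linarith)]
    simp

theorem roleLaw_real_A (hA : 0 ≤ pA) : (roleLaw pA pB).real {Role.A} = pA := by
  simp [Measure.real, roleLaw, hA]

theorem roleLaw_real_B (hB : 0 ≤ pB) : (roleLaw pA pB).real {Role.B} = pB := by
  simp [Measure.real, roleLaw, hB]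

theorem isProbabilityMeasure_coinLaw (hp : p ∈ Set.Icc (0 : ℝ) 1) :
    IsProbabilityMeasure (coinLaw p) where
  measure_univ := by
    simp only [coinLaw, Measure.coe_add, Measure.coe_smul, Pi.add_apply, Pi.smul_apply,
      measure_univ, smul_eq_mul, mul_one]
    rw [← ENNReal.ofReal_add hp.1 (sub_nonneg.mpr hp.2), add_sub_cancel, ENNReal.ofReal_one]

theorem coinLaw_real_false (hp : p ≤ 1) : (coinLaw p).real {false} = 1 - p := by
  simp [Measure.real, coinLaw, hp]

theorem ae_coinLaw_zero : ∀ᵐ b ∂coinLaw 0, b = false := by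
  rw [coinLaw, ENNReal.ofReal_zero, zero_smul, zero_add, sub_zero, ENNReal.ofReal_one, one_smul]
  exact ae_dirac_iff .of_discrete |>.mpr rfl

theorem edgeProb_mem_Icc (h1 : peA ∈ Set.Icc (0 : ℝ) 1) (h2 : peB ∈ Set.Icc (0 : ℝ) 1)
    (h3 : peAB ∈ Set.Icc (0 : ℝ) 1) (c : Fin N → Role) (e : Sym2 (Fin N)) :
    edgeProb peA peB peAB c e ∈ Set.Icc (0 : ℝ) 1 := by
  unfold edgeProb
  split_ifs <;> first | assumption | simp

theorem edgeProb_zero_zero (c : Fin N → Role) (e : Sym2 (Fin N)) :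
    edgeProb 0 0 p c e = if e.map c = s(Role.A, Role.B) then p else 0 := by
  unfold edgeProb
  split_ifs <;> simp_all

theorem isProbabilityMeasure_coinLaw_edgeProb_zero_zero (hp : p ∈ Set.Icc (0 : ℝ) 1)
    (c : Fin N → Role) (e : Sym2 (Fin N)) :
    IsProbabilityMeasure (coinLaw (edgeProb 0 0 p c e)) :=
  isProbabilityMeasure_coinLaw (edgeProb_mem_Icc (Set.left_mem_Icc.mpr zero_le_one)
    (Set.left_mem_Icc.mpr zero_le_one) hp c e)

/-- The conditional law of the edge indicators in `linkGraphLaw`, given the roles `c`. -/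
noncomputable abbrev edgesLaw (peA peB peAB : ℝ) (c : Fin N → Role) :
    Measure (Sym2 (Fin N) → Bool) :=
  Measure.pi fun e => coinLaw (edgeProb peA peB peAB c e)

theorem linkGraphLaw_real_le_add (hA : 0 ≤ pA) (hB : 0 ≤ pB) (hAB : pA + pB ≤ 1)
    (h1 : peA ∈ Set.Icc (0 : ℝ) 1) (h2 : peB ∈ Set.Icc (0 : ℝ) 1) (h3 : peAB ∈ Set.Icc (0 : ℝ) 1)
    (s : Set ((Fin N → Role) × (Sym2 (Fin N) → Bool))) (t : Set (Fin N → Role)) {ε : ℝ}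
    (hε : 0 ≤ ε) (hs : ∀ c ∉ t, (edgesLaw peA peB peAB c).real {E | (c, E) ∈ s} ≤ ε) :
    (linkGraphLaw N pA pB peA peB peAB).real s ≤
      (Measure.pi fun _ : Fin N => roleLaw pA pB).real t + ε := by
  have := isProbabilityMeasure_roleLaw hA hB hAB
  have hcoin := fun c e => isProbabilityMeasure_coinLaw (edgeProb_mem_Icc (N := N) h1 h2 h3 c e)
  have hcond : ∀ c, edgesLaw peA peB peAB c {E | (c, E) ∈ s} ≤
      t.indicator 1 c + ENNReal.ofReal ε := fun c => by
    by_cases hc : c ∈ t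
    · rw [Set.indicator_of_mem hc]
      exact prob_le_one.trans le_self_add
    · rw [Set.indicator_of_notMem hc, zero_add, ← ofReal_measureReal]
      exact ENNReal.ofReal_le_ofReal (hs c hc)
  have hle : linkGraphLaw N pA pB peA peB peAB s ≤
      (Measure.pi fun _ : Fin N => roleLaw pA pB) t + ENNReal.ofReal ε :=
    calc linkGraphLaw N pA pB peA peB peAB s
        = ∫⁻ c, edgesLaw peA peB peAB c {E | (c, E) ∈ s} ∂Measure.pi fun _ => roleLaw pA pB := by
          rw [linkGraphLaw, Measure.bind_apply .of_discrete
            (measurable_of_countable _).aemeasurable]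
          exact lintegral_congr fun c =>
            Measure.map_apply (measurable_of_countable _) .of_discrete
      _ ≤ ∫⁻ c, t.indicator 1 c + ENNReal.ofReal ε ∂Measure.pi fun _ => roleLaw pA pB :=
          lintegral_mono hcond
      _ = (Measure.pi fun _ : Fin N => roleLaw pA pB) t + ENNReal.ofReal ε := by
          rw [lintegral_add_right _ measurable_const, lintegral_indicator_one .of_discrete,
            lintegral_const, measure_univ, mul_one]
  have := ENNReal.toReal_mono (by finiteness) hle
  rwa [ENNReal.toReal_add (by finiteness) (by finiteness), ENNReal.toReal_ofReal hε] at this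

theorem measureReal_card_role_le (hA : 0 ≤ pA) (hB : 0 ≤ pB) (hAB : pA + pB ≤ 1) {r : Role}
    (hp : p ≤ (roleLaw pA pB).real {r}) :
    (Measure.pi fun _ : Fin N => roleLaw pA pB).real {c | #{v | c v = r} ≤ N * p / 4} ≤
      Real.exp (-(N * p / 4)) := by
  have := isProbabilityMeasure_roleLaw hA hB hAB
  have hmean : N * p ≤ ∑ _v : Fin N, (roleLaw pA pB).real {r} := by
    rw [Fin.sum_const, nsmul_eq_mul]
    gcongr
  refine (measureReal_pi_card_le_le_exp (fun _ : Fin N => roleLaw pA pB) (A := fun _ => {r})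
    (fun _ => .of_discrete) Finset.univ (N * p / 4)).trans (Real.exp_le_exp.mpr ?_)
  linarith

/-- The complete bipartite graph between the points of role `A` and those of role `B`. -/
def completeRoleGraph (c : Fin N → Role) : SimpleGraph {v : Fin N // c v ≠ Role.out} :=
  (⊤ : SimpleGraph _).between {v | c v = Role.A} {v | c v = Role.B}

variable {c : Fin N → Role} {E : Sym2 (Fin N) → Bool}

theorem completeRoleGraph_adj {u v : {v : Fin N // c v ≠ Role.out}} :
    (completeRoleGraph c).Adj u v ↔ s(c u, c v) = s(Role.A, Role.B) := by
  have hne : s(c u, c v) = s(Role.A, Role.B) → u ≠ v := by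
    rintro h rfl
    rcases Sym2.eq_iff.mp h with ⟨hA, hB⟩ | ⟨hB, hA⟩ <;> cases hA.symm.trans hB
  simp only [completeRoleGraph, SimpleGraph.between_adj, SimpleGraph.top_adj, Set.mem_ofPred_eq,
    ← Sym2.eq_iff]
  exact and_iff_right_of_imp hne

theorem sampledGraph_adj {u v : {v : Fin N // c v ≠ Role.out}} :
    (sampledGraph (c, E)).Adj u v ↔ E s(u, v) = true ∧ u ≠ v := by
  simp [sampledGraph, Subtype.val_inj]

open Classical in
theorem degree_completeRoleGraph {r : Role} {v : {v : Fin N // c v ≠ Role.out}}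
    (h : s(c v, r) = s(Role.A, Role.B)) :
    (completeRoleGraph c).degree v = #{w | c w = r} := by
  have hr : r ≠ Role.out := by
    rintro rfl
    simp at h
  rw [← SimpleGraph.card_neighborFinset_eq_degree, ← Finset.card_map (.subtype _)]
  congr 1
  ext w
  simp only [Finset.mem_map, SimpleGraph.mem_neighborFinset, completeRoleGraph_adj, ← h,
    Sym2.congr_right, Finset.mem_filter_univ, Function.Embedding.subtype_apply]
  exact ⟨by rintro ⟨w, hw, rfl⟩; exact hw, fun hw => ⟨⟨w, hw ▸ hr⟩, hw, rfl⟩⟩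

open Classical in
theorem lt_degree_completeRoleGraph {M : ℝ} (hA : M < #{v | c v = Role.A})
    (hB : M < #{v | c v = Role.B}) (v : {v : Fin N // c v ≠ Role.out}) :
    M < (completeRoleGraph c).degree v := by
  rcases hv : c v with _ | _ | _
  · rwa [degree_completeRoleGraph (r := Role.B) (by rw [hv])]
  · rwa [degree_completeRoleGraph (r := Role.A) (by rw [hv, Sym2.eq_swap])]
  · exact absurd hv v.2

open Classical in
/-- The pairs `s(v, w)` with `w` in the part opposite to `v`: the possible edges at `v`. -/
noncomputable def crossPairs (c : Fin N → Role) (v : {v : Fin N // c v ≠ Role.out}) :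
    Finset (Sym2 (Fin N)) :=
  ((completeRoleGraph c).neighborFinset v).map
    ((Function.Embedding.subtype _).trans (Sym2.mkEmbedding v.1))

open Classical in
theorem card_crossPairs (v : {v : Fin N // c v ≠ Role.out}) :
    #(crossPairs c v) = (completeRoleGraph c).degree v := by
  rw [crossPairs, Finset.card_map, SimpleGraph.card_neighborFinset_eq_degree]

theorem map_eq_of_mem_crossPairs {v : {v : Fin N // c v ≠ Role.out}} {e : Sym2 (Fin N)}
    (he : e ∈ crossPairs c v) : e.map c = s(Role.A, Role.B) := by
  obtain ⟨w, hw, rfl⟩ := Finset.mem_map.mp he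
  rwa [SimpleGraph.mem_neighborFinset, completeRoleGraph_adj] at hw

open Classical in
theorem degree_completeRoleGraph_sdiff_sampledGraph (v : {v : Fin N // c v ≠ Role.out}) :
    (completeRoleGraph c \ sampledGraph (c, E)).degree v =
      #{e ∈ crossPairs c v | E e = false} := by
  rw [← SimpleGraph.card_neighborFinset_eq_degree, crossPairs, Finset.filter_map, Finset.card_map]
  congr 1
  ext w
  simp only [SimpleGraph.mem_neighborFinset, SimpleGraph.sdiff_adj, sampledGraph_adj,
    Finset.mem_filter]
  refine and_congr_right fun h => ?_
  simp [h.ne]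

theorem ae_sampledGraph_le_completeRoleGraph (hp : p ∈ Set.Icc (0 : ℝ) 1) :
    ∀ᵐ E ∂edgesLaw 0 0 p c, sampledGraph (c, E) ≤ completeRoleGraph c := by
  have := isProbabilityMeasure_coinLaw_edgeProb_zero_zero hp c
  have hfalse : ∀ e, e.map c ≠ s(Role.A, Role.B) → ∀ᵐ E ∂edgesLaw 0 0 p c, E e = false :=
    fun e he => by
      refine (measurePreserving_eval (fun e => coinLaw (edgeProb 0 0 p c e))
        e).quasiMeasurePreserving.ae (p := (· = false)) ?_
      rw [edgeProb_zero_zero, if_neg he]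
      exact ae_coinLaw_zero
  filter_upwards [ae_all_iff.mpr fun e => eventually_imp_distrib_left.mpr (hfalse e)]
    with E hE u v
  rw [sampledGraph_adj, completeRoleGraph_adj]
  contrapose!
  intro huv
  simp [hE s(u, v) huv]

open Classical in
theorem measureReal_mul_degree_le_degree_sdiff (hq : q ∈ Set.Icc (0 : ℝ) 1) {ε : ℝ}
    (hqε : 4 * q ≤ ε) (v : {v : Fin N // c v ≠ Role.out}) :
    (edgesLaw 0 0 (1 - q) c).real {E | ε * (completeRoleGraph c).degree v ≤
      (completeRoleGraph c \ sampledGraph (c, E)).degree v} ≤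
      Real.exp (-(ε / 2 * (completeRoleGraph c).degree v)) := by
  have := isProbabilityMeasure_coinLaw_edgeProb_zero_zero (Set.Icc.mem_iff_one_sub_mem.mp hq) c
  have hmean : ∑ e ∈ crossPairs c v, (coinLaw (edgeProb 0 0 (1 - q) c e)).real {false} =
      #(crossPairs c v) * q := by
    rw [← nsmul_eq_mul]
    refine Finset.sum_eq_card_nsmul fun e he => ?_
    rw [edgeProb_zero_zero, if_pos (map_eq_of_mem_crossPairs he),
      coinLaw_real_false (sub_le_self 1 hq.1), sub_sub_cancel]
  simp only [degree_completeRoleGraph_sdiff_sampledGraph]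
  rw [← card_crossPairs]
  refine (measureReal_pi_le_card_le_exp (fun e => coinLaw (edgeProb 0 0 (1 - q) c e))
    (A := fun _ => {false}) (fun _ => .of_discrete) (crossPairs c v) _).trans
    (Real.exp_le_exp.mpr ?_)
  rw [hmean]
  nlinarith

open Classical in
theorem spectralGapGT_sampledGraph [Nonempty {v : Fin N // c v ≠ Role.out}] {δ : ℝ} (hδ : 0 < δ)
    (hle : sampledGraph (c, E) ≤ completeRoleGraph c)
    (hdeg : ∀ v, ((completeRoleGraph c \ sampledGraph (c, E)).degree v : ℝ) <
      δ / (1 + δ) * (completeRoleGraph c).degree v) :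
    SpectralGapGT (sampledGraph (c, E)) (1 - δ) := by
  refine spectralGapGT_of_le_between
    (Set.disjoint_left.mpr fun v hA hB => by cases hA.symm.trans hB) hle fun v => ?_
  have hsum : ((completeRoleGraph c).degree v : ℝ) = (sampledGraph (c, E)).degree v +
      (completeRoleGraph c \ sampledGraph (c, E)).degree v := by
    exact_mod_cast (degree_add_degree_sdiff hle v).symm
  have hmissing := hdeg v
  rw [hsum, div_mul_eq_mul_div, lt_div_iff₀ (by positivity)] at hmissing
  have hlt : ((completeRoleGraph c \ sampledGraph (c, E)).degree v : ℝ) <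
      δ * (sampledGraph (c, E)).degree v := by
    linarith
  convert hlt
  rfl

open Classical in
theorem measureReal_not_spectralGapGT_le (hq : q ∈ Set.Icc (0 : ℝ) 1) {δ M : ℝ} (hδ : 0 < δ)
    (hqδ : 4 * q ≤ δ / (1 + δ)) (hM : 0 ≤ M) (hA : M < #{v | c v = Role.A})
    (hB : M < #{v | c v = Role.B}) :
    (edgesLaw 0 0 (1 - q) c).real {E | ¬ SpectralGapGT (sampledGraph (c, E)) (1 - δ)} ≤
      N * Real.exp (-(δ / (1 + δ) / 2 * M)) := by
  have hq' := Set.Icc.mem_iff_one_sub_mem.mp hq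
  have := isProbabilityMeasure_coinLaw_edgeProb_zero_zero hq' c
  have : Nonempty {v : Fin N // c v ≠ Role.out} := by
    obtain ⟨v, hv⟩ := Finset.card_pos.mp (Nat.cast_pos.mp (hM.trans_lt hA))
    exact ⟨v, by simp_all⟩
  have hsub : {E | ¬ SpectralGapGT (sampledGraph (c, E)) (1 - δ)} ≤ᵐ[edgesLaw 0 0 (1 - q) c]
      ⋃ v, {E | δ / (1 + δ) * (completeRoleGraph c).degree v ≤
        (completeRoleGraph c \ sampledGraph (c, E)).degree v} := by
    filter_upwards [ae_sampledGraph_le_completeRoleGraph hq'] with E hle hE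
    by_contra hdeg
    exact hE (spectralGapGT_sampledGraph hδ hle fun v =>
      not_le.mp fun hv => hdeg (Set.mem_iUnion.mpr ⟨v, hv⟩))
  have hcard : Fintype.card {v : Fin N // c v ≠ Role.out} ≤ N :=
    (Fintype.card_subtype_le _).trans_eq (Fintype.card_fin N)
  calc (edgesLaw 0 0 (1 - q) c).real {E | ¬ SpectralGapGT (sampledGraph (c, E)) (1 - δ)}
      ≤ ∑ v, Real.exp (-(δ / (1 + δ) / 2 * (completeRoleGraph c).degree v)) :=
        (ENNReal.toReal_mono (by finiteness) (measure_mono_ae hsub)).trans <|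
          (measureReal_iUnion_fintype_le _).trans <| Finset.sum_le_sum fun v _ =>
            measureReal_mul_degree_le_degree_sdiff hq hqδ v
    _ ≤ ∑ _v : {v : Fin N // c v ≠ Role.out}, Real.exp (-(δ / (1 + δ) / 2 * M)) := by
        gcongr with v
        exact (lt_degree_completeRoleGraph hA hB v).le
    _ ≤ N * Real.exp (-(δ / (1 + δ) / 2 * M)) := by
        rw [Finset.sum_const, Finset.card_univ, nsmul_eq_mul]
        gcongr

theorem one_sub_le_measureReal_spectralGapGT (hp : 0 ≤ p) (hpA : p ≤ pA) (hpB : p ≤ pB)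
    (hAB : pA + pB ≤ 1) (hq : 0 ≤ q) {δ : ℝ} (hδ : 0 < δ) (hqδ : 4 * q ≤ δ / (1 + δ)) :
    1 - (N + 2) * Real.exp (-(δ / (1 + δ) / 8 * (N * p))) ≤
      (linkGraphLaw N pA pB 0 0 (1 - q)).real {ω | SpectralGapGT (sampledGraph ω) (1 - δ)} := by
  have hε : δ / (1 + δ) ≤ 1 := (div_le_one (by positivity)).mpr (by linarith)
  have hA := hp.trans hpA
  have hB := hp.trans hpB
  have hz : (0 : ℝ) ∈ Set.Icc (0 : ℝ) 1 := Set.left_mem_Icc.mpr zero_le_one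
  have hq01 : q ∈ Set.Icc (0 : ℝ) 1 := ⟨hq, by linarith⟩
  have hq' := Set.Icc.mem_iff_one_sub_mem.mp hq01
  have := isProbabilityMeasure_linkGraphLaw N hA hB hAB hz hz hq'
  set bad : Role → Set (Fin N → Role) := fun r => {c | #{v | c v = r} ≤ N * p / 4}
  have hroles : ∀ r, p ≤ (roleLaw pA pB).real {r} →
      (Measure.pi fun _ : Fin N => roleLaw pA pB).real (bad r) ≤
        Real.exp (-(δ / (1 + δ) / 8 * (N * p))) := fun r hr =>
    (measureReal_card_role_le hA hB hAB hr).trans <| Real.exp_le_exp.mpr <| by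
      have : 0 ≤ N * p := by positivity
      nlinarith
  have hbad := linkGraphLaw_real_le_add hA hB hAB hz hz hq'
    {ω | SpectralGapGT (sampledGraph ω) (1 - δ)}ᶜ (bad Role.A ∪ bad Role.B)
    (ε := N * Real.exp (-(δ / (1 + δ) / 8 * (N * p)))) (by positivity) fun c hc => by
      simp only [bad, Set.mem_union, Set.mem_ofPred_eq, not_or, not_le] at hc
      refine (measureReal_not_spectralGapGT_le hq01 hδ hqδ (by positivity) hc.1 hc.2).trans_eq ?_
      congr 3
      ring
  have hunion := measureReal_union_le (μ := Measure.pi fun _ : Fin N => roleLaw pA pB)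
    (bad Role.A) (bad Role.B)
  rw [probReal_compl_eq_one_sub .of_discrete] at hbad
  linarith [hroles Role.A (hpA.trans_eq (roleLaw_real_A hA).symm),
    hroles Role.B (hpB.trans_eq (roleLaw_real_B hB).symm)]

end Model

section Asymptotics

theorem tendsto_rpow_div_log_atTop {β : ℝ} (hβ : 0 < β) :
    Tendsto (fun x : ℝ => x ^ β / Real.log x) atTop atTop := by
  have hpos : ∀ᶠ x : ℝ in atTop, 0 < Real.log x / x ^ β := by
    filter_upwards [eventually_gt_atTop 1] with x hx
    exact div_pos (Real.log_pos hx) (Real.rpow_pos_of_pos (zero_lt_one.trans hx) _)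
  have h := (tendsto_nhdsWithin_iff.mpr
    ⟨(isLittleO_log_rpow_atTop hβ).tendsto_div_nhds_zero, hpos⟩).inv_tendsto_nhdsGT_zero
  simpa only [Pi.inv_def, inv_div] using h

theorem withOverwhelmingProbability_of_pow_mul_exp_le {P f : ℕ → ℝ} (k : ℕ)
    (hf : Tendsto (fun n : ℕ => f n / Real.log n) atTop atTop)
    (hP : ∀ᶠ n : ℕ in atTop, 1 - (n : ℝ) ^ k * Real.exp (-f n) ≤ P n) :
    WithOverwhelmingProbability P := by
  refine ⟨fun n => f n / Real.log n - k, tendsto_atTop_add_const_right _ _ hf, ?_⟩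
  filter_upwards [hP, eventually_ge_atTop 2] with n hn h2
  have hn1 : (1 : ℝ) < n := Nat.one_lt_cast.mpr h2
  have hlog : Real.log n ≠ 0 := (Real.log_pos hn1).ne'
  rw [neg_sub, Real.rpow_sub (by positivity), Real.rpow_natCast,
    Real.rpow_def_of_pos (by positivity), mul_div_cancel₀ _ hlog, div_eq_mul_inv, ← Real.exp_neg]
  exact hn

/-- The probability that a vertex of the random graph with edge probability `x ^ (-α)` is adjacent
to `d` given vertices and to none of `d` further ones. It is the probability of each of the roles
`A` and `B` in the main theorem. -/
noncomputable def linkDensity (d : ℕ) (α x : ℝ) : ℝ :=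
  x ^ (-(d * α)) * (1 - x ^ (-α)) ^ d

theorem tendsto_one_sub_rpow_neg_pow_atTop {α : ℝ} (hα : 0 < α) (d : ℕ) :
    Tendsto (fun x : ℝ => (1 - x ^ (-α)) ^ d) atTop (𝓝 1) := by
  simpa using ((tendsto_rpow_neg_atTop hα).const_sub 1).pow d

theorem tendsto_linkDensity_atTop_nhds_zero {d : ℕ} (hd : d ≠ 0) {α : ℝ} (hα : 0 < α) :
    Tendsto (fun x => linkDensity d α x) atTop (𝓝 0) := by
  have hdα : 0 < d * α := mul_pos (Nat.cast_pos.mpr (Nat.pos_of_ne_zero hd)) hα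
  simpa [linkDensity] using
    (tendsto_rpow_neg_atTop hdα).mul (tendsto_one_sub_rpow_neg_pow_atTop hα d)

theorem eventually_linkDensity_add_self_le_one {d : ℕ} (hd : d ≠ 0) {α : ℝ} (hα : 0 < α) :
    ∀ᶠ x in atTop, linkDensity d α x + linkDensity d α x ≤ 1 := by
  filter_upwards [(tendsto_linkDensity_atTop_nhds_zero hd hα).eventually_le_const one_half_pos]
    with x hx
  exact (add_le_add hx hx).trans_eq (add_halves 1)

theorem tendsto_natCast_sub_div_natCast_atTop (k : ℕ) :
    Tendsto (fun n : ℕ => ((n - k : ℕ) : ℝ) / n) atTop (𝓝 1) := by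
  have h := (tendsto_const_div_atTop_nhds_zero_nat (k : ℝ)).const_sub 1
  rw [sub_zero] at h
  refine h.congr' ?_
  filter_upwards [eventually_gt_atTop k] with n hn
  have hn0 : (n : ℝ) ≠ 0 := Nat.cast_ne_zero.mpr (Nat.ne_zero_of_lt hn)
  rw [Nat.cast_sub hn.le, sub_div, div_self hn0]

theorem tendsto_sub_mul_linkDensity_div_log_atTop {d : ℕ} {α : ℝ} (hα : 0 < α)
    (hdα : d * α < 1) (k : ℕ) :
    Tendsto (fun n : ℕ => (n - k : ℕ) * linkDensity d α n / Real.log n) atTop atTop := by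
  have hmain := ((tendsto_rpow_div_log_atTop (sub_pos.mpr hdα)).comp
    tendsto_natCast_atTop_atTop).atTop_mul_pos (zero_lt_one.trans_eq (one_mul 1).symm)
      ((tendsto_natCast_sub_div_natCast_atTop k).mul
        ((tendsto_one_sub_rpow_neg_pow_atTop hα d).comp tendsto_natCast_atTop_atTop))
  refine hmain.congr' ?_
  filter_upwards [eventually_gt_atTop 0] with n hn
  have hn0 : (0 : ℝ) < n := Nat.cast_pos.mpr hn
  simp only [Function.comp_apply]
  rw [linkDensity, sub_eq_add_neg 1 (d * α), Real.rpow_add hn0, Real.rpow_one]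
  field_simp

end Asymptotics

theorem mainTheorem11_general {N : ℕ → ℕ} {pA pB q : ℕ → ℝ} {δ : ℝ} (hδ : 0 < δ)
    (hN : ∀ᶠ n in atTop, N n ≤ n) (hAB : ∀ᶠ n in atTop, pA n + pB n ≤ 1)
    (hq : ∀ᶠ n in atTop, 0 ≤ q n) (hq0 : Tendsto q atTop (𝓝 0))
    (hmean : Tendsto (fun n => N n * min (pA n) (pB n) / Real.log n) atTop atTop) :
    WithOverwhelmingProbability fun n =>
      (linkGraphLaw (N n) (pA n) (pB n) 0 0 (1 - q n)).real
        {ω | SpectralGapGT (sampledGraph ω) (1 - δ)} := by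
  set κ := δ / (1 + δ)
  have hκ : 0 < κ := by positivity
  refine withOverwhelmingProbability_of_pow_mul_exp_le 2
    (f := fun n => κ / 8 * (N n * min (pA n) (pB n))) ?_ ?_
  · simpa only [mul_div_assoc] using hmean.const_mul_atTop (div_pos hκ (by norm_num : (0 : ℝ) < 8))
  filter_upwards [hN, hAB, hq, hq0.eventually_le_const (div_pos hκ (by norm_num : (0 : ℝ) < 4)),
    hmean.eventually_gt_atTop 0, eventually_ge_atTop 2] with n hNn hABn hqn hqκ hpos hn
  have hlog : 0 < Real.log n := Real.log_pos (Nat.one_lt_cast.mpr hn)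
  have hp : 0 < min (pA n) (pB n) :=
    pos_of_mul_pos_right ((div_pos_iff_of_pos_right hlog).mp hpos) (Nat.cast_nonneg _)
  have hNn2 : (N n + 2 : ℝ) ≤ (n : ℝ) ^ 2 := by
    have : N n + 2 ≤ n ^ 2 := by nlinarith
    exact_mod_cast this
  refine le_trans ?_ (one_sub_le_measureReal_spectralGapGT hp.le (min_le_left _ _)
    (min_le_right _ _) hABn hqn hδ (by linarith))
  gcongr

theorem mainTheorem11 (d : ℕ) (hd : 1 ≤ d) (α : ℝ) (hα : 0 < α) (hαd : α < 1 / (d : ℝ))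
    (δ : ℝ) (hδ : 0 < δ) :
    WithOverwhelmingProbability fun n : ℕ =>
      (linkGraphLaw (n - 2 * d)
        ((n : ℝ) ^ (-((d : ℝ) * α)) * (1 - (n : ℝ) ^ (-α)) ^ d)
        ((n : ℝ) ^ (-((d : ℝ) * α)) * (1 - (n : ℝ) ^ (-α)) ^ d)
        0 0 (1 - (n : ℝ) ^ (-α))).real
        {ω | SpectralGapGT (sampledGraph ω) (1 - δ)} := by
  have hdα : d * α < 1 := (lt_div_iff₀' (Nat.cast_pos.mpr hd)).mp hαd
  exact mainTheorem11_general hδ (.of_forall fun n => n.sub_le (2 * d))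
    (tendsto_natCast_atTop_atTop.eventually
      (eventually_linkDensity_add_self_le_one (Nat.ne_of_gt hd) hα))
    (.of_forall fun n => by positivity)
    ((tendsto_rpow_neg_atTop hα).comp tendsto_natCast_atTop_atTop)
    (by simpa only [min_self, linkDensity] using
      tendsto_sub_mul_linkDensity_div_log_atTop hα hdα (2 * d))
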